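/- Let $\Gamma=(V,E,s,t)$ be a finite directed graph without sinks (the source map $s:E\to V$ is surjective), and let $D$ be its vertex matrix, i.e. $D_{vw}$ is the number of edges from $v$ to $w$; $\rho(D)$ denotes the spectral radius of $D$. Let $C^*(\Gamma)$ be the graph $C^*$-algebra, that is, the universal $C^*$-algebra generated by mutually orthogonal projections $(p_v)_{v\in V}$ and partial isometries $(S_e)_{e\in E}$ with $$S_e^*S_e=p_{t(e)}\quad(e\in E),\qquad \sum_{s(e)=v}S_eS_e^*=p_v\quad(v\in V),$$ with the dynamics $\sigma_r=\gamma_{e^{ir}}$ $(r\in\mathbb R)$, where $\gamma$ is the gauge action of the unit circle, $\gamma_z(p_v)=p_v$, $\gamma_z(S_e)=zS_e$. A $\mathrm{KMS}_\beta$ state ($\beta\in\mathbb R$) is a state $\tau$ on $C^*(\Gamma)$ with $\tau(ab)=\tau(b\,\sigma_{i\beta}(a))$ for all analytic elements $a,b$ of $(C^*(\Gamma),\sigma)$. (1) Suppose that there is a vector ${\bf x}\in\mathbb R^V$ with strictly positive entries and ${\bf x}^TD=\rho(D)\,{\bf x}^T$. If $C^*(\Gamma)$ has a $\mathrm{KMS}_\beta$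 state, then $\beta=\ln\rho(D)$. (2) Suppose that $\Gamma$ is circulant, i.e. the cyclic group $\mathbb Z_m$, $m=|V|$, acting on $V$ by cyclic rotation of the $m$ vertices, acts by automorphisms of $\Gamma$ (equivalently, some automorphism of $\Gamma$ permutes the vertices in a single cycle of length $m$). If $C^*(\Gamma)$ has a $\mathrm{KMS}_\beta$ state, then $\beta=\ln\rho(D)$. -/

import Mathlib

universe u

open scoped ENNReal

/-! ## Directed graphs, vertex matrix -/

/-- A directed graph (multiple edges and loops allowed) with vertex set `V`, edge set `E`, source
map `s` and target map `t`. -/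
structure DirectedGraph (V E : Type u) where
  s : E → V
  t : E → V

namespace DirectedGraph

variable {V E : Type u} (Γ : DirectedGraph V E)

/-- Every vertex emits at least one edge. -/
def WithoutSinks : Prop := Function.Surjective Γ.s

/-- The vertex matrix over a semiring `R`: the `(v, w)` entry is the number of edges from `v` to
`w`. -/
noncomputable def vertexMatrix (R : Type*) [NatCast R] : Matrix V V R :=
  Matrix.of fun v w => (Nat.card {e : E // Γ.s e = v ∧ Γ.t e = w} : R)

/-- The spectral radius `ρ(D)` of the vertex matrix `D`: the largest modulus of a complex
eigenvalue of `D`. -/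
noncomputable def rho [Fintype V] [DecidableEq V] : ℝ :=
  (spectralRadius ℂ (Γ.vertexMatrix ℂ)).toReal

/-- An automorphism of a directed graph: a permutation of the vertices and a permutation of the
edges that are compatible with the source and target maps. -/
structure Automorphism where
  vertexPerm : Equiv.Perm V
  edgePerm : Equiv.Perm E
  s_edgePerm : ∀ e, Γ.s (edgePerm e) = vertexPerm (Γ.s e)
  t_edgePerm : ∀ e, Γ.t (edgePerm e) = vertexPerm (Γ.t e)

/-- A graph on `m` vertices is circulant if the cyclic group `ℤ/m`, acting by cyclic rotation of
the `m` vertices, acts by graph automorphisms: some automorphism moves the vertices in a single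
cycle through all of them. -/
def IsCirculant : Prop :=
  ∃ g : Γ.Automorphism, ∀ v w : V, g.vertexPerm.SameCycle v w

/-! ## Cuntz-Krieger families and the graph C⋆-algebra -/

/-- Mutually orthogonal projections `p v` and partial isometries `S e` in a C⋆-algebra `B` with
`S e⋆ S e = p (t e)` and `∑_{s e = v} S e S e⋆ = p v`. -/
structure CuntzKriegerFamily [Fintype E] [DecidableEq V] (B : Type*) [NonUnitalCStarAlgebra B] where
  p : V → B
  S : E → B
  isStarProjection_p : ∀ v, IsStarProjection (p v)
  p_mul_p : ∀ v w, v ≠ w → p v * p w = 0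
  partialIsometry_S : ∀ e, S e * star (S e) * S e = S e
  star_S_mul_S : ∀ e, star (S e) * S e = p (Γ.t e)
  sum_S_mul_star_S : ∀ v, ∑ e with Γ.s e = v, S e * star (S e) = p v

/-- A representation of `Γ`: a C⋆-algebra with a Cuntz-Krieger `Γ`-family in it. -/
structure Representation [Fintype E] [DecidableEq V] where
  carrier : Type u
  [cstar : NonUnitalCStarAlgebra carrier]
  family : Γ.CuntzKriegerFamily carrier

attribute [instance] Representation.cstar

variable [Fintype E] [DecidableEq V]

theorem CuntzKriegerFamily.norm_p_le {Γ : DirectedGraph V E} {B : Type*} [NonUnitalCStarAlgebra B]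
    (F : Γ.CuntzKriegerFamily B) (v : V) : ‖F.p v‖ ≤ 1 := by
  have h : ‖F.p v‖ = ‖F.p v‖ * ‖F.p v‖ := by
    conv_lhs => rw [← (F.isStarProjection_p v).isIdempotentElem.eq]
    nth_rewrite 1 [← (F.isStarProjection_p v).isSelfAdjoint.star_eq]
    exact CStarRing.norm_star_mul_self
  nlinarith [norm_nonneg (F.p v)]

theorem CuntzKriegerFamily.norm_S_le {Γ : DirectedGraph V E} {B : Type*} [NonUnitalCStarAlgebra B]
    (F : Γ.CuntzKriegerFamily B) (e : E) : ‖F.S e‖ ≤ 1 := by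
  have h : ‖star (F.S e) * F.S e‖ = ‖F.S e‖ * ‖F.S e‖ := CStarRing.norm_star_mul_self
  rw [F.star_S_mul_S] at h
  nlinarith [norm_nonneg (F.S e), F.norm_p_le (Γ.t e)]

/-- The C⋆-algebra of all norm-bounded families indexed by the representations of `Γ`. -/
abbrev RepProduct : Type (u + 1) := lp (fun π : Γ.Representation => π.carrier) ∞

/-- The vertex projection in the product of all representations. -/
noncomputable def prodP (v : V) : Γ.RepProduct :=
  ⟨fun π => π.family.p v,
    memℓp_infty ⟨1, by rintro _ ⟨π, rfl⟩; exact π.family.norm_p_le v⟩⟩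

/-- The edge partial isometry in the product of all representations. -/
noncomputable def prodS (e : E) : Γ.RepProduct :=
  ⟨fun π => π.family.S e,
    memℓp_infty ⟨1, by rintro _ ⟨π, rfl⟩; exact π.family.norm_S_le e⟩⟩

/-- The closed ⋆-subalgebra of the product of all representations generated by the universal
Cuntz-Krieger family. -/
noncomputable def universalSubalgebra : NonUnitalStarSubalgebra ℂ Γ.RepProduct :=
  (NonUnitalStarAlgebra.adjoin ℂ
    (Set.range Γ.prodP ∪ Set.range Γ.prodS)).topologicalClosure

/-- The graph C⋆-algebra `C⋆(Γ)`: the universal C⋆-algebra generated by a Cuntz-Krieger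
`Γ`-family, constructed inside the product of all such families. Its universal property is
`GraphCStarAlgebra.existsUnique_lift`. (A C⋆-algebra generated by finitely many elements has at
most the cardinality of the continuum, so that the universe of the representations is no
restriction.) -/
def GraphCStarAlgebra : Type (u + 1) := Γ.universalSubalgebra

namespace GraphCStarAlgebra

noncomputable instance : NonUnitalCStarAlgebra Γ.GraphCStarAlgebra :=
  NonUnitalStarSubalgebra.nonUnitalCStarAlgebra Γ.universalSubalgebra
    (h_closed := NonUnitalStarSubalgebra.isClosed_topologicalClosure _)

/-- The inclusion of `C⋆(Γ)` in the product of all representations. -/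
noncomputable def incl : Γ.GraphCStarAlgebra →⋆ₙₐ[ℂ] Γ.RepProduct :=
  NonUnitalStarSubalgebraClass.subtype Γ.universalSubalgebra

theorem isometry_incl : Isometry (incl Γ) := isometry_subtype_coe

theorem incl_mem (x : Γ.GraphCStarAlgebra) : incl Γ x ∈ Γ.universalSubalgebra := x.2

/-- The generating projections of `C⋆(Γ)`. -/
noncomputable def p (v : V) : Γ.GraphCStarAlgebra :=
  ⟨Γ.prodP v, NonUnitalStarSubalgebra.le_topologicalClosure _
    (NonUnitalStarAlgebra.subset_adjoin ℂ _ (Or.inl ⟨v, rfl⟩))⟩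

/-- The generating partial isometries of `C⋆(Γ)`. -/
noncomputable def S (e : E) : Γ.GraphCStarAlgebra :=
  ⟨Γ.prodS e, NonUnitalStarSubalgebra.le_topologicalClosure _
    (NonUnitalStarAlgebra.subset_adjoin ℂ _ (Or.inr ⟨e, rfl⟩))⟩

variable {Γ}

/-- Evaluation of an element of `C⋆(Γ)` at a representation. -/
noncomputable def eval (π : Γ.Representation) : Γ.GraphCStarAlgebra →⋆ₙₐ[ℂ] π.carrier where
  toFun x := incl Γ x π
  map_smul' c x := by rw [map_smul]; rfl
  map_zero' := by rw [map_zero]; rfl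
  map_add' x y := by rw [map_add]; rfl
  map_mul' x y := by rw [map_mul]; rfl
  map_star' x := by rw [map_star]; rfl

theorem eval_p (π : Γ.Representation) (v : V) : eval π (p Γ v) = π.family.p v := rfl

theorem eval_S (π : Γ.Representation) (e : E) : eval π (S Γ e) = π.family.S e := rfl

theorem ext_eval {x y : Γ.GraphCStarAlgebra} (h : ∀ π : Γ.Representation, eval π x = eval π y) :
    x = y :=
  (isometry_incl Γ).injective (lp.ext (funext h))

variable (Γ) in
/-- The generators of `C⋆(Γ)` form a Cuntz-Krieger `Γ`-family. -/
noncomputable def family : Γ.CuntzKriegerFamily Γ.GraphCStarAlgebra where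
  p := p Γ
  S := S Γ
  isStarProjection_p v :=
    ⟨ext_eval fun π => by
        rw [map_mul, eval_p]; exact (π.family.isStarProjection_p v).isIdempotentElem,
      ext_eval fun π => by
        rw [map_star, eval_p]; exact (π.family.isStarProjection_p v).isSelfAdjoint⟩
  p_mul_p v w h := ext_eval fun π => by
    rw [map_mul, eval_p, eval_p, map_zero, π.family.p_mul_p v w h]
  partialIsometry_S e := ext_eval fun π => by
    simp only [map_mul, map_star, eval_S, π.family.partialIsometry_S]
  star_S_mul_S e := ext_eval fun π => by
    simp only [map_mul, map_star, eval_S, eval_p, π.family.star_S_mul_S]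
  sum_S_mul_star_S v := ext_eval fun π => by
    simp only [map_sum, map_mul, map_star, eval_S, eval_p, π.family.sum_S_mul_star_S]

/-- Induction principle: a closed condition on `C⋆(Γ)` that is stable under the ⋆-algebra
operations holds everywhere once it holds for the generators. -/
theorem induction_on {P : Γ.GraphCStarAlgebra → Prop} (hp : ∀ v, P (p Γ v)) (hS : ∀ e, P (S Γ e))
    (hzero : P 0) (hadd : ∀ x y, P x → P y → P (x + y)) (hmul : ∀ x y, P x → P y → P (x * y))
    (hsmul : ∀ (c : ℂ) x, P x → P (c • x)) (hstar : ∀ x, P x → P (star x))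
    (hclosed : IsClosed {x | P x}) (x : Γ.GraphCStarAlgebra) : P x := by
  have hcl : IsClosed (incl Γ '' {x | P x}) :=
    (isometry_incl Γ).isClosedEmbedding.isClosedMap _ hclosed
  let T : NonUnitalStarSubalgebra ℂ Γ.RepProduct :=
    { carrier := incl Γ '' {x | P x}
      add_mem' := by
        rintro _ _ ⟨a, ha, rfl⟩ ⟨b, hb, rfl⟩
        exact ⟨a + b, hadd a b ha hb, map_add _ _ _⟩
      zero_mem' := ⟨0, hzero, map_zero _⟩
      mul_mem' := by
        rintro _ _ ⟨a, ha, rfl⟩ ⟨b, hb, rfl⟩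
        exact ⟨a * b, hmul a b ha hb, map_mul _ _ _⟩
      smul_mem' := by
        rintro c _ ⟨a, ha, rfl⟩
        exact ⟨c • a, hsmul c a ha, map_smul _ _ _⟩
      star_mem' := by
        rintro _ ⟨a, ha, rfl⟩
        exact ⟨star a, hstar a ha, map_star _ _⟩ }
  have hle : Γ.universalSubalgebra ≤ T := by
    refine NonUnitalStarSubalgebra.topologicalClosure_minimal _ ?_ hcl
    refine NonUnitalStarAlgebra.adjoin_le ?_
    rintro _ (⟨v, rfl⟩ | ⟨e, rfl⟩)
    · exact ⟨p Γ v, hp v, rfl⟩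
    · exact ⟨S Γ e, hS e, rfl⟩
  obtain ⟨y, hy, hyx⟩ := hle (incl_mem Γ x)
  rwa [(isometry_incl Γ).injective hyx] at hy

/-- The universal property of `C⋆(Γ)`: every Cuntz-Krieger `Γ`-family in a C⋆-algebra `B` comes
from exactly one ⋆-homomorphism `C⋆(Γ) → B`. -/
theorem existsUnique_lift {B : Type u} [NonUnitalCStarAlgebra B] (F : Γ.CuntzKriegerFamily B) :
    ∃! φ : Γ.GraphCStarAlgebra →⋆ₙₐ[ℂ] B,
      (∀ v, φ (p Γ v) = F.p v) ∧ ∀ e, φ (S Γ e) = F.S e := by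
  refine ⟨eval ⟨B, F⟩, ⟨fun v => rfl, fun e => rfl⟩, ?_⟩
  rintro φ ⟨h1, h2⟩
  have hc : ∀ ψ : Γ.GraphCStarAlgebra →⋆ₙₐ[ℂ] B, Continuous ψ := fun ψ =>
    AddMonoidHomClass.continuous_of_bound ψ 1 fun x => by
      simpa using NonUnitalStarAlgHom.norm_apply_le ψ x
  refine NonUnitalStarAlgHom.ext fun x => ?_
  induction x using induction_on with
  | hp v => exact h1 v
  | hS e => exact h2 e
  | hzero => simp
  | hadd x y hx hy => simp [hx, hy]
  | hmul x y hx hy => simp [hx, hy]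
  | hsmul c x hx => simp [hx]
  | hstar x hx => simp [map_star, hx]
  | hclosed => exact isClosed_eq (hc _) (hc _)

end GraphCStarAlgebra

/-! ## The gauge action -/

/-- The Cuntz-Krieger family `(p, z S)`, for `z` in the unit circle. -/
noncomputable def CuntzKriegerFamily.rotate {Γ : DirectedGraph V E} {B : Type*}
    [NonUnitalCStarAlgebra B] (z : Circle) (F : Γ.CuntzKriegerFamily B) :
    Γ.CuntzKriegerFamily B :=
  have hz : ∀ x y : B, ((z : ℂ) • x) * star ((z : ℂ) • y) = x * star y := fun x y => by
    have h : (z : ℂ) * star (z : ℂ) = 1 := by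
      rw [Complex.star_def, Complex.mul_conj]; simp
    rw [star_smul, smul_mul_smul_comm, h, one_smul]
  have hz' : ∀ x y : B, star ((z : ℂ) • x) * ((z : ℂ) • y) = star x * y := fun x y => by
    have h : star (z : ℂ) * (z : ℂ) = 1 := by
      rw [mul_comm, Complex.star_def, Complex.mul_conj]; simp
    rw [star_smul, smul_mul_smul_comm, h, one_smul]
  { p := F.p
    S := fun e => (z : ℂ) • F.S e
    isStarProjection_p := F.isStarProjection_p
    p_mul_p := F.p_mul_p
    partialIsometry_S := fun e => by rw [hz, mul_smul_comm, F.partialIsometry_S]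
    star_S_mul_S := fun e => by rw [hz', F.star_S_mul_S]
    sum_S_mul_star_S := fun v => by simp only [hz, F.sum_S_mul_star_S] }

/-- The representation with `S` replaced by `z S`. -/
noncomputable abbrev Representation.rotate {Γ : DirectedGraph V E} (z : Circle)
    (π : Γ.Representation) : Γ.Representation where
  carrier := π.carrier
  family := π.family.rotate z

theorem Representation.rotate_rotate {Γ : DirectedGraph V E} (z w : Circle)
    (π : Γ.Representation) : (π.rotate z).rotate w = π.rotate (z * w) := by
  simp only [Representation.rotate, CuntzKriegerFamily.rotate, Circle.coe_mul, smul_smul,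
    mul_comm (w : ℂ)]

theorem Representation.rotate_one {Γ : DirectedGraph V E} (π : Γ.Representation) :
    π.rotate 1 = π := by
  simp only [Representation.rotate, CuntzKriegerFamily.rotate, Circle.coe_one, one_smul]

/-- The automorphism of the product of all representations that permutes the representations by
`S ↦ z S`. -/
noncomputable def prodGauge (z : Circle) : Γ.RepProduct →⋆ₙₐ[ℂ] Γ.RepProduct where
  toFun f := ⟨fun π => (f (π.rotate z) : π.carrier), memℓp_infty ⟨‖f‖, by
    rintro _ ⟨π, rfl⟩
    exact lp.norm_apply_le_norm ENNReal.top_ne_zero f (π.rotate z)⟩⟩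
  map_smul' _ _ := rfl
  map_zero' := rfl
  map_add' _ _ := rfl
  map_mul' _ _ := rfl
  map_star' _ := rfl

theorem prodGauge_apply (z : Circle) (f : Γ.RepProduct) (π : Γ.Representation) :
    Γ.prodGauge z f π = (f (π.rotate z) : π.carrier) := rfl

theorem norm_prodGauge_le (z : Circle) (f : Γ.RepProduct) : ‖Γ.prodGauge z f‖ ≤ ‖f‖ :=
  lp.norm_le_of_forall_le (norm_nonneg f) fun π =>
    lp.norm_apply_le_norm ENNReal.top_ne_zero f (π.rotate z)

theorem continuous_prodGauge (z : Circle) : Continuous (Γ.prodGauge z) :=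
  AddMonoidHomClass.continuous_of_bound (Γ.prodGauge z) 1 fun x => by
    simpa using Γ.norm_prodGauge_le z x

theorem prodGauge_prodP (z : Circle) (v : V) : Γ.prodGauge z (Γ.prodP v) = Γ.prodP v := rfl

theorem prodGauge_prodS (z : Circle) (e : E) :
    Γ.prodGauge z (Γ.prodS e) = (z : ℂ) • Γ.prodS e := rfl

theorem prodGauge_mul (z w : Circle) (f : Γ.RepProduct) :
    Γ.prodGauge (z * w) f = Γ.prodGauge z (Γ.prodGauge w f) := by
  refine lp.ext (funext fun π => eq_of_heq ?_)
  have h : ∀ ρ ρ' : Γ.Representation, ρ = ρ' → HEq (f ρ) (f ρ') := by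
    rintro ρ _ rfl; rfl
  exact h _ _ (π.rotate_rotate z w).symm

theorem prodGauge_one (f : Γ.RepProduct) : Γ.prodGauge 1 f = f := by
  refine lp.ext (funext fun π => eq_of_heq ?_)
  have h : ∀ ρ ρ' : Γ.Representation, ρ = ρ' → HEq (f ρ) (f ρ') := by
    rintro ρ _ rfl; rfl
  exact h _ _ π.rotate_one

theorem prodGauge_mem (z : Circle) {f : Γ.RepProduct} (hf : f ∈ Γ.universalSubalgebra) :
    Γ.prodGauge z f ∈ Γ.universalSubalgebra := by
  have hle : Γ.universalSubalgebra ≤ Γ.universalSubalgebra.comap (Γ.prodGauge z) := by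
    refine NonUnitalStarSubalgebra.topologicalClosure_minimal _ ?_
      ((NonUnitalStarSubalgebra.isClosed_topologicalClosure _).preimage
        (Γ.continuous_prodGauge z))
    refine NonUnitalStarAlgebra.adjoin_le ?_
    rintro _ (⟨v, rfl⟩ | ⟨e, rfl⟩)
    · change Γ.prodGauge z (Γ.prodP v) ∈ Γ.universalSubalgebra
      rw [prodGauge_prodP]
      exact GraphCStarAlgebra.incl_mem Γ (GraphCStarAlgebra.p Γ v)
    · change Γ.prodGauge z (Γ.prodS e) ∈ Γ.universalSubalgebra
      rw [prodGauge_prodS]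
      exact SMulMemClass.smul_mem _ (GraphCStarAlgebra.incl_mem Γ (GraphCStarAlgebra.S Γ e))
  exact hle hf

namespace GraphCStarAlgebra

/-- The gauge automorphism `γ_z` of `C⋆(Γ)`, determined by `γ_z (p v) = p v` and
`γ_z (S e) = z S e`. -/
noncomputable def gauge (z : Circle) : Γ.GraphCStarAlgebra ≃⋆ₐ[ℂ] Γ.GraphCStarAlgebra where
  toFun x := ⟨Γ.prodGauge z (incl Γ x), Γ.prodGauge_mem z (incl_mem Γ x)⟩
  invFun x := ⟨Γ.prodGauge z⁻¹ (incl Γ x), Γ.prodGauge_mem z⁻¹ (incl_mem Γ x)⟩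
  left_inv x := (isometry_incl Γ).injective <| by
    change Γ.prodGauge z⁻¹ (Γ.prodGauge z (incl Γ x)) = incl Γ x
    rw [← prodGauge_mul, inv_mul_cancel, prodGauge_one]
  right_inv x := (isometry_incl Γ).injective <| by
    change Γ.prodGauge z (Γ.prodGauge z⁻¹ (incl Γ x)) = incl Γ x
    rw [← prodGauge_mul, mul_inv_cancel, prodGauge_one]
  map_mul' _ _ := rfl
  map_add' _ _ := rfl
  map_star' _ := rfl
  map_smul' _ _ := rfl

variable {Γ}

theorem incl_gauge (z : Circle) (x : Γ.GraphCStarAlgebra) :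
    incl Γ (gauge Γ z x) = Γ.prodGauge z (incl Γ x) := rfl

theorem gauge_p (z : Circle) (v : V) : gauge Γ z (p Γ v) = p Γ v := rfl

theorem gauge_S (z : Circle) (e : E) : gauge Γ z (S Γ e) = (z : ℂ) • S Γ e := rfl

theorem gauge_mul (z w : Circle) (x : Γ.GraphCStarAlgebra) :
    gauge Γ (z * w) x = gauge Γ z (gauge Γ w x) :=
  (isometry_incl Γ).injective (Γ.prodGauge_mul z w _)

theorem gauge_one (x : Γ.GraphCStarAlgebra) : gauge Γ 1 x = x :=
  (isometry_incl Γ).injective (Γ.prodGauge_one _)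

theorem norm_gauge_le (z : Circle) (x : Γ.GraphCStarAlgebra) : ‖gauge Γ z x‖ ≤ ‖x‖ :=
  Γ.norm_prodGauge_le z (incl Γ x)

theorem continuous_gauge (x : Γ.GraphCStarAlgebra) : Continuous fun z : Circle => gauge Γ z x := by
  induction x using induction_on with
  | hp v => simpa only [gauge_p] using continuous_const
  | hS e =>
    simp only [gauge_S]
    exact Continuous.smul (f := fun z : Circle => (z : ℂ)) (by fun_prop) continuous_const
  | hzero => simpa only [map_zero] using continuous_const
  | hadd x y hx hy => simp only [map_add]; exact hx.add hy
  | hmul x y hx hy => simp only [map_mul]; exact hx.mul hy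
  | hsmul c x hx => simp only [map_smul]; exact hx.const_smul c
  | hstar x hx => simp only [map_star]; exact hx.star
  | hclosed =>
    refine isClosed_of_closure_subset fun x hx => ?_
    refine continuous_of_uniform_approx_of_continuous fun U hU => ?_
    obtain ⟨ε, hε, hεU⟩ := Metric.mem_uniformity_dist.1 hU
    obtain ⟨y, hy, hxy⟩ := Metric.mem_closure_iff.1 hx ε hε
    refine ⟨fun z => gauge Γ z y, hy, fun z => hεU ?_⟩
    rw [dist_eq_norm, ← map_sub]
    exact (norm_gauge_le z _).trans_lt (by rwa [← dist_eq_norm])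

end GraphCStarAlgebra

end DirectedGraph

/-! ## C⋆-dynamical systems and KMS states -/

/-- A C⋆-dynamical system: a strongly continuous one-parameter group of ⋆-automorphisms. -/
structure CStarDynamics (A : Type*) [NonUnitalCStarAlgebra A] where
  σ : ℝ → A ≃⋆ₐ[ℂ] A
  σ_zero : ∀ a, σ 0 a = a
  σ_add : ∀ r t a, σ (r + t) a = σ r (σ t a)
  continuous_σ : ∀ a, Continuous fun t => σ t a

/-- A state on a C⋆-algebra: a positive linear functional of norm one. -/
structure IsState {A : Type*} [NonUnitalCStarAlgebra A] (τ : A →L[ℂ] ℂ) : Prop where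
  nonneg : ∀ a, 0 ≤ (τ (star a * a)).re ∧ (τ (star a * a)).im = 0
  norm_eq_one : ‖τ‖ = 1

namespace CStarDynamics

variable {A : Type*} [NonUnitalCStarAlgebra A] (𝒟 : CStarDynamics A)

/-- `f` is the (unique) entire extension `z ↦ σ_z(a)` of the orbit `t ↦ σ_t(a)`. -/
def IsEntireExtension (a : A) (f : ℂ → A) : Prop :=
  Differentiable ℂ f ∧ ∀ t : ℝ, f t = 𝒟.σ t a

/-- `a` is an analytic element: its orbit extends to an entire function. -/
def IsAnalyticElement (a : A) : Prop := ∃ f : ℂ → A, 𝒟.IsEntireExtension a f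

/-- `τ` is a `KMS_β` state: a state with `τ(ab) = τ(b σ_{iβ}(a))` for all analytic elements
`a`, `b`. -/
def IsKMSState (β : ℝ) (τ : A →L[ℂ] ℂ) : Prop :=
  IsState τ ∧ ∀ a b : A, ∀ f : ℂ → A, 𝒟.IsEntireExtension a f → 𝒟.IsAnalyticElement b →
    τ (a * b) = τ (b * f (Complex.I * β))

end CStarDynamics

/-- The dynamics `t ↦ γ_{exp(it)}` on `C⋆(Γ)` coming from the gauge action. -/
noncomputable def DirectedGraph.gaugeDynamics {V E : Type u} [Fintype E] [DecidableEq V]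
    (Γ : DirectedGraph V E) : CStarDynamics Γ.GraphCStarAlgebra where
  σ t := GraphCStarAlgebra.gauge Γ (Circle.exp t)
  σ_zero a := by rw [Circle.exp_zero, GraphCStarAlgebra.gauge_one]
  σ_add r t a := by rw [Circle.exp_add, GraphCStarAlgebra.gauge_mul]
  continuous_σ a := (GraphCStarAlgebra.continuous_gauge a).comp Circle.exp.continuous

/-! Let `τ` be a `KMS_β` state and `y v = τ (p v)`, a vector with nonnegative entries. The KMS
condition for `S e` and `star (S e)` gives `τ (S e * star (S e)) = exp (-β) * y (t e)`; summing over
the edges that leave `v` yields `D y = exp β • y`. Pairing with a left eigenvector `x` for `ρ(D)`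
gives `exp β * (x ⬝ᵥ y) = ρ(D) * (x ⬝ᵥ y)`, and the pairing is positive when `x > 0` and `y ≠ 0`.

That `y ≠ 0` is the analytic point: `∑ v, p v` is a unit of `C⋆(Γ)`, and a positive functional
vanishing on a unit is zero. In the circulant case all in-degrees equal some `d`, so the all-ones
vector is a left eigenvector and `ρ(D) = d`. -/

theorem eq_zero_of_sum_mul_star_self_eq_zero {ι B : Type*} [Fintype ι] [NonUnitalCStarAlgebra B]
    (T : ι → B) (h : ∑ i, T i * star (T i) = 0) (i : ι) : T i = 0 := by
  -- In the spectral order of the unitization every summand is nonnegative, so a zero sum forces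
  -- each to vanish.
  let _ := CStarAlgebra.spectralOrder (Unitization ℂ B)
  have _ := CStarAlgebra.spectralOrderedRing (Unitization ℂ B)
  have h' : ∑ i, (T i : Unitization ℂ B) * star (T i : Unitization ℂ B) = 0 := by
    have := congrArg (Unitization.inrNonUnitalStarAlgHom ℂ B) h
    rwa [map_sum, map_zero, Finset.sum_congr rfl fun i _ =>
      (map_mul (Unitization.inrNonUnitalStarAlgHom ℂ B) _ _).trans
        (congrArg _ (map_star (Unitization.inrNonUnitalStarAlgHom ℂ B) _))] at this
  have hi := (Finset.sum_eq_zero_iff_of_nonneg fun i _ => mul_star_self_nonneg _).1 h' i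
    (Finset.mem_univ i)
  exact Unitization.inr_injective (CStarRing.mul_star_self_eq_zero_iff _ |>.1 hi)

namespace DirectedGraph

/-! ### Column sums and spectral radius of the vertex matrix. -/

section VertexMatrix

variable {V E : Type u} [Fintype V] [DecidableEq V] (Γ : DirectedGraph V E)

theorem sum_vertexMatrix_col {V E : Type u} [Fintype V] (Γ : DirectedGraph V E) [Fintype E] (R : Type*) [Semiring R] (w : V) :
    ∑ v, Γ.vertexMatrix R v w = (Nat.card {e : E // Γ.t e = w} : R) := by
  have h : ∑ v, Nat.card {e : E // Γ.s e = v ∧ Γ.t e = w} = Nat.card {e : E // Γ.t e = w} := by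
    rw [← Nat.card_sigma]
    exact Nat.card_congr
      { toFun := fun x => ⟨x.2.1, x.2.2.2⟩
        invFun := fun e => ⟨Γ.s e.1, e.1, rfl, e.2⟩
        left_inv := by rintro ⟨v, e, rfl, h⟩; rfl
        right_inv := fun _ => rfl }
  simp only [vertexMatrix, Matrix.of_apply]
  rw [← h, Nat.cast_sum]

theorem sum_vertexMatrix_mul [Fintype E] (y : V → ℝ) (v : V) :
    ∑ w, Γ.vertexMatrix ℝ v w * y w = ∑ e with Γ.s e = v, y (Γ.t e) := by
  have h : ∀ w, Γ.vertexMatrix ℝ v w * y w =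
      ∑ e with Γ.s e = v, if Γ.t e = w then y w else 0 := fun w => by
    rw [← Finset.sum_filter, Finset.filter_filter, Finset.sum_const, nsmul_eq_mul, vertexMatrix,
      Matrix.of_apply, Nat.card_eq_fintype_card, Fintype.card_subtype]
  simp only [h]
  rw [Finset.sum_comm]
  simp

/-- The number of edges ending at a vertex of a circulant graph does not depend on the vertex. -/
theorem IsCirculant.card_target_eq {V E : Type u} {Γ : DirectedGraph V E} (h : Γ.IsCirculant)
    (v w : V) :
    Nat.card {e : E // Γ.t e = v} = Nat.card {e : E // Γ.t e = w} := by
  obtain ⟨g, hg⟩ := h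
  have step : ∀ v, Nat.card {e : E // Γ.t e = v} = Nat.card {e : E // Γ.t e = g.vertexPerm v} :=
    fun v => Nat.card_congr <| g.edgePerm.subtypeEquiv fun e => by
      rw [g.t_edgePerm, g.vertexPerm.injective.eq_iff]
  -- `SameCycle` provides an integer exponent, so negative powers are needed too.
  have inv : ∀ (n : ℤ) (v : V), Nat.card {e : E // Γ.t e = (g.vertexPerm ^ n) v} =
      Nat.card {e : E // Γ.t e = v} := fun n v => by
    induction n with
    | zero => simp
    | succ n ih => rw [add_comm, zpow_add, zpow_one, Equiv.Perm.mul_apply, ← step, ih]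
    | pred n ih =>
      rw [step, ← Equiv.Perm.mul_apply, ← zpow_one_add]
      simpa using ih
  obtain ⟨n, rfl⟩ := hg v w
  exact (inv n v).symm

/-- If all columns of the vertex matrix have the same sum `d`, then its spectral radius is `d`. -/
theorem rho_eq_of_sum_col [Nonempty V] (d : ℕ) (h : ∀ w, ∑ v, Γ.vertexMatrix ℂ v w = d) :
    Γ.rho = d := by
  have hcol : ∀ w, ∑ v, ‖Γ.vertexMatrix ℂ v w‖ = d := fun w => by
    have := congrArg Complex.re (h w)
    simpa [vertexMatrix] using this
  have hsr : spectralRadius ℂ (Γ.vertexMatrix ℂ) = (d : ℝ≥0∞) := by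
    -- Upper bound: column sums `d` make `D` expand the `ℓ¹` norm by at most `d`, which bounds every
    -- eigenvalue. Lower bound: `d` is an eigenvalue, with left eigenvector `1`.
    refine le_antisymm (iSup₂_le fun k hk => ?_) ?_
    · rw [spectrum.mem_iff, Matrix.isUnit_iff_isUnit_det, isUnit_iff_ne_zero, not_not,
        ← Matrix.exists_mulVec_eq_zero_iff] at hk
      obtain ⟨z, hz, hkz⟩ := hk
      have hk' : ∀ v, k * z v = ∑ w, Γ.vertexMatrix ℂ v w * z w := fun v => by
        have := congrFun hkz v
        rw [Matrix.sub_mulVec, Algebra.algebraMap_eq_smul_one, Matrix.smul_mulVec,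
          Matrix.one_mulVec] at this
        simpa [sub_eq_zero, Matrix.mulVec, dotProduct] using this
      have hpos : 0 < ∑ v, ‖z v‖ := by
        obtain ⟨i, hi⟩ := Function.ne_iff.1 hz
        exact Finset.sum_pos' (fun _ _ => norm_nonneg _) ⟨i, Finset.mem_univ i, norm_pos_iff.2 hi⟩
      have hle : ‖k‖ * ∑ v, ‖z v‖ ≤ d * ∑ v, ‖z v‖ :=
        calc ‖k‖ * ∑ v, ‖z v‖ = ∑ v, ‖∑ w, Γ.vertexMatrix ℂ v w * z w‖ := by
              simp only [← hk', norm_mul, Finset.mul_sum]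
          _ ≤ ∑ v, ∑ w, ‖Γ.vertexMatrix ℂ v w‖ * ‖z w‖ :=
              Finset.sum_le_sum fun v _ => (norm_sum_le _ _).trans_eq (by simp only [norm_mul])
          _ = d * ∑ v, ‖z v‖ := by
              rw [Finset.sum_comm, Finset.mul_sum]
              simp only [← Finset.sum_mul, hcol]
      have : ‖k‖₊ ≤ (d : NNReal) := by
        rw [← NNReal.coe_le_coe]
        simpa using le_of_mul_le_mul_right hle hpos
      exact_mod_cast this
    · have hd : (d : ℂ) ∈ spectrum ℂ (Γ.vertexMatrix ℂ) := by
        rw [spectrum.mem_iff, Matrix.isUnit_iff_isUnit_det, isUnit_iff_ne_zero, not_not,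
          ← Matrix.exists_vecMul_eq_zero_iff]
        refine ⟨1, one_ne_zero, ?_⟩
        rw [Matrix.vecMul_sub, Algebra.algebraMap_eq_smul_one, Matrix.vecMul_smul,
          Matrix.vecMul_one, sub_eq_zero]
        ext w
        simp [Matrix.vecMul, dotProduct, h]
      refine le_trans ?_ (le_iSup₂ (f := fun (k : ℂ) (_ : k ∈ spectrum ℂ (Γ.vertexMatrix ℂ)) =>
        (‖k‖₊ : ℝ≥0∞)) (d : ℂ) hd)
      simp
  rw [rho, hsr, ENNReal.toReal_natCast]

theorem IsCirculant.one_vecMul_vertexMatrix [Fintype E] [Nonempty V] {Γ : DirectedGraph V E}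
    (h : Γ.IsCirculant) : Matrix.vecMul 1 (Γ.vertexMatrix ℝ) = Γ.rho • (1 : V → ℝ) := by
  obtain ⟨v₀⟩ := ‹Nonempty V›
  have : Nonempty V := ⟨v₀⟩
  rw [Γ.rho_eq_of_sum_col (Nat.card {e : E // Γ.t e = v₀}) fun w => by
    rw [sum_vertexMatrix_col, h.card_target_eq w v₀]]
  ext w
  simpa [Matrix.vecMul, dotProduct, sum_vertexMatrix_col] using h.card_target_eq w v₀

end VertexMatrix

/-! ### The sum of the vertex projections as a unit. -/

section Unit

variable {V E : Type u} [Fintype V] [DecidableEq V] [Fintype E] {Γ : DirectedGraph V E}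

namespace CuntzKriegerFamily

variable {B : Type*} [NonUnitalCStarAlgebra B] (F : Γ.CuntzKriegerFamily B)

theorem sum_p_mul_p (v : V) : (∑ w, F.p w) * F.p v = F.p v := by
  rw [Finset.sum_mul, Finset.sum_eq_single v (fun w _ h => F.p_mul_p w v h) (by simp)]
  exact (F.isStarProjection_p v).isIdempotentElem

theorem S_mul_p {V E : Type u} [DecidableEq V] [Fintype E] {Γ : DirectedGraph V E}
    (F : Γ.CuntzKriegerFamily B) (e : E) : F.S e * F.p (Γ.t e) = F.S e := by
  rw [← F.star_S_mul_S, ← mul_assoc, F.partialIsometry_S]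

theorem star_sum_p : star (∑ v, F.p v) = ∑ v, F.p v := by
  rw [star_sum]
  exact Finset.sum_congr rfl fun v _ => (F.isStarProjection_p v).isSelfAdjoint

theorem S_mul_sum_p (e : E) : F.S e * ∑ v, F.p v = F.S e := by
  have h : F.p (Γ.t e) * ∑ v, F.p v = F.p (Γ.t e) := by
    have := congrArg star (F.sum_p_mul_p (Γ.t e))
    rwa [star_mul, star_sum_p, (F.isStarProjection_p _).isSelfAdjoint.star_eq] at this
  rw [← F.S_mul_p, mul_assoc, h]

/-- The final projections of the edges of `Γ` sum to the sum of the vertex projections. -/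
theorem sum_S_mul_star_S_univ : ∑ e, F.S e * star (F.S e) = ∑ v, F.p v := by
  simp only [← F.sum_S_mul_star_S]
  exact (Finset.sum_fiberwise _ _ _).symm

/-- Positivity is used here. With `u = ∑ v, F.p v`, the defects `T e = S e - u * S e` satisfy `∑ e,
T e * star (T e) = u - u² - (u² - u³) = 0`, so each of them vanishes. -/
theorem sum_p_mul_S (e : E) : (∑ v, F.p v) * F.S e = F.S e := by
  have hu : (∑ v, F.p v) * ∑ v, F.p v = ∑ v, F.p v := by
    conv_lhs => rw [Finset.mul_sum]
    simp only [sum_p_mul_p]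
  have hT : ∀ e, (F.S e - (∑ v, F.p v) * F.S e) * star (F.S e - (∑ v, F.p v) * F.S e) =
      F.S e * star (F.S e) - F.S e * star (F.S e) * (∑ v, F.p v) -
        ((∑ v, F.p v) * (F.S e * star (F.S e)) -
          (∑ v, F.p v) * (F.S e * star (F.S e)) * (∑ v, F.p v)) := fun e => by
    rw [star_sub, star_mul, star_sum_p]
    noncomm_ring
  have h0 : ∑ e, (F.S e - (∑ v, F.p v) * F.S e) * star (F.S e - (∑ v, F.p v) * F.S e) = 0 := by
    simp only [hT, Finset.sum_sub_distrib, ← Finset.sum_mul, ← Finset.mul_sum,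
      sum_S_mul_star_S_univ, hu, sub_self]
  exact (sub_eq_zero.1 (eq_zero_of_sum_mul_star_self_eq_zero _ h0 e)).symm

end CuntzKriegerFamily

/-- The sum of the vertex projections is a unit of `C⋆(Γ)`. -/
theorem GraphCStarAlgebra.sum_p_mul_and_mul_sum_p (x : Γ.GraphCStarAlgebra) :
    (∑ v, p Γ v) * x = x ∧ x * (∑ v, p Γ v) = x := by
  have hs : star (∑ v, p Γ v) = ∑ v, p Γ v := (family Γ).star_sum_p
  -- Adjoints exchange the left and right identities, so the induction carries both.
  have hstar : ∀ x : Γ.GraphCStarAlgebra, (∑ v, p Γ v) * x = x ∧ x * (∑ v, p Γ v) = x →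
      (∑ v, p Γ v) * star x = star x ∧ star x * (∑ v, p Γ v) = star x := fun x hx => by
    have h1 := congrArg star hx.1
    have h2 := congrArg star hx.2
    rw [star_mul, hs] at h1 h2
    exact ⟨h2, h1⟩
  induction x using induction_on with
  | hp v =>
    have h : (∑ w, p Γ w) * p Γ v = p Γ v := (family Γ).sum_p_mul_p v
    have h' := congrArg star h
    have hv : star (p Γ v) = p Γ v := ((family Γ).isStarProjection_p v).isSelfAdjoint
    rw [star_mul, hs, hv] at h'
    exact ⟨h, h'⟩
  | hS e => exact ⟨(family Γ).sum_p_mul_S e, (family Γ).S_mul_sum_p e⟩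
  | hzero => simp
  | hadd x y hx hy => rw [mul_add, add_mul, hx.1, hx.2, hy.1, hy.2]; exact ⟨rfl, rfl⟩
  | hmul x y hx hy => rw [← mul_assoc, hx.1, mul_assoc, hy.2]; exact ⟨rfl, rfl⟩
  | hsmul c x hx => rw [mul_smul_comm, smul_mul_assoc, hx.1, hx.2]; exact ⟨rfl, rfl⟩
  | hstar x hx => exact hstar x hx
  | hclosed =>
    exact (isClosed_eq (continuous_const.mul continuous_id) continuous_id).inter
      (isClosed_eq (continuous_id.mul continuous_const) continuous_id)

end Unit

end DirectedGraph

/-! ### Positive functionals and the unit. -/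

/-- A positive functional that vanishes on a self-adjoint unit vanishes. -/
theorem eq_zero_of_nonneg_of_apply_unit_eq_zero {A : Type*} [NonUnitalCStarAlgebra A]
    (τ : A →L[ℂ] ℂ) (hτ : ∀ a, 0 ≤ (τ (star a * a)).re ∧ (τ (star a * a)).im = 0)
    (u : A) (hu : star u = u) (hl : ∀ a, u * a = a) (hr : ∀ a, a * u = a) (h0 : τ u = 0) :
    τ = 0 := by
  -- The quadratic term `|c|² τ u` is zero, so positivity constrains an expression that is
  -- real-affine in `c`.
  have key : ∀ (a : A) (c : ℂ), τ (star (a + c • u) * (a + c • u)) =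
      τ (star a * a) + c * τ (star a) + star c * τ a := fun a c => by
    rw [star_add, star_smul, hu, mul_add, add_mul, add_mul]
    simp only [smul_mul_assoc, mul_smul_comm, hl, hr, map_add, map_smul, h0, smul_eq_mul]
    ring
  have lin : ∀ K L : ℝ, (∀ t : ℝ, 0 ≤ K + t * L) → L = 0 := fun K L h => by
    by_contra hL
    -- At this `t` the affine function takes the value `-1`.
    have := h (-(K + 1) / L)
    rw [div_mul_cancel₀ _ hL] at this
    linarith
  have him : ∀ a, (τ a).im = 0 := fun a => by
    have h1 : (τ (star a)).im + (τ a).im = 0 := by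
      have h := (hτ (a + (1 : ℂ) • u)).2
      rw [key] at h
      simpa [(hτ a).2] using h
    have h2 : (τ a).im - (τ (star a)).im = 0 := by
      refine lin (τ (star a * a)).re _ fun t => ?_
      have h := (hτ (a + (t * Complex.I : ℂ) • u)).1
      rw [key] at h
      simp at h
      linarith
    linarith
  ext a
  refine Complex.ext ?_ (him a)
  -- The imaginary part of `τ (i a)` is the real part of `τ a`.
  simpa using him (Complex.I • a)

/-! ### KMS states on the vertex projections. -/

namespace DirectedGraph

variable {V E : Type u} [DecidableEq V] [Fintype E] {Γ : DirectedGraph V E}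

open GraphCStarAlgebra

/-- At `z = iβ` the scalar `exp (z * I)` becomes `exp (-β)`, the factor in the KMS relation. -/
theorem isEntireExtension_S (e : E) :
    Γ.gaugeDynamics.IsEntireExtension (S Γ e) fun z => Complex.exp (z * Complex.I) • S Γ e := by
  refine ⟨fun z => ?_, fun t => ?_⟩
  · exact DifferentiableAt.smul_const (by fun_prop) _
  · change _ = gauge Γ (Circle.exp t) (S Γ e)
    rw [gauge_S, Circle.coe_exp]

theorem isAnalyticElement_star_S (e : E) :
    Γ.gaugeDynamics.IsAnalyticElement (star (S Γ e)) := by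
  refine ⟨fun z => Complex.exp (-z * Complex.I) • star (S Γ e), fun z => ?_, fun t => ?_⟩
  · exact DifferentiableAt.smul_const (by fun_prop) _
  · change _ = gauge Γ (Circle.exp t) (star (S Γ e))
    rw [map_star, gauge_S, star_smul, Circle.coe_exp, Complex.star_def, ← Complex.exp_conj]
    simp

theorem apply_S_mul_star_S_of_isKMSState {β : ℝ} {τ : Γ.GraphCStarAlgebra →L[ℂ] ℂ}
    (h : Γ.gaugeDynamics.IsKMSState β τ) (e : E) :
    τ (S Γ e * star (S Γ e)) = Real.exp (-β) * τ (p Γ (Γ.t e)) := by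
  have hs : star (S Γ e) * S Γ e = p Γ (Γ.t e) := (family Γ).star_S_mul_S e
  rw [h.2 _ _ _ (isEntireExtension_S e) (isAnalyticElement_star_S e), mul_smul_comm, map_smul, hs,
    smul_eq_mul, mul_right_comm, Complex.I_mul_I]
  simp

/-- The values of a `KMS_β` state on the vertex projections are an eigenvector of the vertex
matrix with eigenvalue `exp β`. -/
theorem sum_vertexMatrix_mul_apply_p_of_isKMSState [Fintype V] {β : ℝ} {τ : Γ.GraphCStarAlgebra →L[ℂ] ℂ}
    (h : Γ.gaugeDynamics.IsKMSState β τ) (v : V) :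
    ∑ w, Γ.vertexMatrix ℝ v w * (τ (p Γ w)).re = Real.exp β * (τ (p Γ v)).re := by
  have hs : ∑ e with Γ.s e = v, S Γ e * star (S Γ e) = p Γ v := (family Γ).sum_S_mul_star_S v
  rw [sum_vertexMatrix_mul, ← hs, map_sum, Complex.re_sum, Finset.mul_sum]
  refine Finset.sum_congr rfl fun e _ => ?_
  rw [apply_S_mul_star_S_of_isKMSState h, Complex.re_ofReal_mul, ← mul_assoc, ← Real.exp_add]
  simp

theorem apply_p_nonneg {τ : Γ.GraphCStarAlgebra →L[ℂ] ℂ} (h : IsState τ) (v : V) :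
    0 ≤ (τ (p Γ v)).re ∧ (τ (p Γ v)).im = 0 := by
  have hp := (family Γ).isStarProjection_p v
  have hv : star (p Γ v) * p Γ v = p Γ v := by
    rw [show star (p Γ v) = p Γ v from hp.isSelfAdjoint]
    exact hp.isIdempotentElem
  simpa only [hv] using h.nonneg (p Γ v)

/-- Otherwise `τ` kills the unit `∑ v, p v`, hence is zero, against `‖τ‖ = 1`. -/
theorem exists_apply_p_pos [Fintype V] {τ : Γ.GraphCStarAlgebra →L[ℂ] ℂ} (h : IsState τ) :
    ∃ v, 0 < (τ (p Γ v)).re := by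
  by_contra! hle
  have h0 : τ (∑ v, p Γ v) = 0 := by
    rw [map_sum]
    exact Finset.sum_eq_zero fun v _ =>
      Complex.ext (le_antisymm (hle v) (apply_p_nonneg h v).1) (apply_p_nonneg h v).2
  have hτ : τ = 0 := eq_zero_of_nonneg_of_apply_unit_eq_zero τ h.nonneg _ (family Γ).star_sum_p
    (fun a => (sum_p_mul_and_mul_sum_p a).1) (fun a => (sum_p_mul_and_mul_sum_p a).2) h0
  have := h.norm_eq_one
  simp [hτ] at this

theorem eq_log_rho_of_isKMSState [Fintype V] {x : V → ℝ} (hx : ∀ i, 0 < x i)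
    (hxD : Matrix.vecMul x (Γ.vertexMatrix ℝ) = Γ.rho • x) {β : ℝ}
    {τ : Γ.GraphCStarAlgebra →L[ℂ] ℂ} (h : Γ.gaugeDynamics.IsKMSState β τ) :
    β = Real.log Γ.rho := by
  let y : V → ℝ := fun v => (τ (p Γ v)).re
  have hy : Matrix.mulVec (Γ.vertexMatrix ℝ) y = Real.exp β • y :=
    funext fun v => sum_vertexMatrix_mul_apply_p_of_isKMSState h v
  have hpos : 0 < x ⬝ᵥ y := by
    obtain ⟨v, hv⟩ := exists_apply_p_pos h.1
    exact Finset.sum_pos' (fun w _ => mul_nonneg (hx w).le (apply_p_nonneg h.1 w).1)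
      ⟨v, Finset.mem_univ v, mul_pos (hx v) hv⟩
  -- Both sides evaluate `xᵀ D y`, once through each eigenvector.
  have heq : Real.exp β * (x ⬝ᵥ y) = Γ.rho * (x ⬝ᵥ y) := by
    have := Matrix.dotProduct_mulVec x (Γ.vertexMatrix ℝ) y
    rwa [hy, hxD, dotProduct_smul, smul_dotProduct] at this
  rw [← mul_right_cancel₀ hpos.ne' heq, Real.log_exp]

end DirectedGraph

theorem mainTheorem7 :
    (∀ {V E : Type u} [Fintype V] [DecidableEq V] [Fintype E] (Γ : DirectedGraph V E),
      Γ.WithoutSinks →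
      ∀ x : V → ℝ, (∀ i, 0 < x i) → Matrix.vecMul x (Γ.vertexMatrix ℝ) = Γ.rho • x →
      ∀ (β : ℝ) (τ : Γ.GraphCStarAlgebra →L[ℂ] ℂ),
        Γ.gaugeDynamics.IsKMSState β τ → β = Real.log Γ.rho) ∧
    (∀ {V E : Type u} [Fintype V] [DecidableEq V] [Fintype E] (Γ : DirectedGraph V E),
      Γ.WithoutSinks → Γ.IsCirculant →
      ∀ (β : ℝ) (τ : Γ.GraphCStarAlgebra →L[ℂ] ℂ),
        Γ.gaugeDynamics.IsKMSState β τ → β = Real.log Γ.rho) := by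
  refine ⟨fun Γ _ x hx hxD β τ h => Γ.eq_log_rho_of_isKMSState hx hxD h,
    fun Γ _ hΓ β τ h => ?_⟩
  -- The state itself supplies a vertex, as the computation of `ρ(D)` requires `Nonempty V`.
  have := (DirectedGraph.exists_apply_p_pos h.1).nonempty
  exact DirectedGraph.eq_log_rho_of_isKMSState (x := 1) (fun _ => one_pos)
    hΓ.one_vecMul_vertexMatrix h
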